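/- Let $Q$ be a smooth manifold of dimension $n>2$ with a smooth pseudo-Riemannian metric of arbitrary signature, given by its contravariant tensor $\mathbf G=(g^{ij})$. Let $\mathbf L=(L^{ij})$ be an L-tensor on $Q$: a smooth symmetric contravariant 2-tensor field such that * $\mathbf L$ is a conformal Killing tensor, i.e. there is a vector field $\mathbf C$ with $[\mathbf L,\mathbf G]=2\,\mathbf C\odot\mathbf G$, where $[\cdot,\cdot]$ is the Lie–Schouten bracket and $\odot$ the symmetric tensor product; * at every point the endomorphism $L^i{}_j=L^{ik}g_{kj}$ of the tangent space has simple eigenvalues, i.e. its characteristic polynomial has no multiple complex root; * the Nijenhuis torsion of $(L^i{}_j)$ vanishes. Then no eigenvector of $\mathbf L$ is proportional to a proper conformal Killing vector. That is, if $\mathbf E$ is a field of eigenvectors of $(L^i{}_j)$ on $Q$ (nowhere zero, not assumed smooth), $\varphi:Q\to\mathbb R$ is any function, and $\mathbf X=\varphi\,\mathbf E$ is a smooth vector field, then there is no function $F:Q\to\mathbb R$, not identically zero, with $\mathcal L_{\mathbf X}\mathbf G=F\,\mathbf G$. -/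

import Mathlib

open scoped Manifold ContDiff

noncomputable section

namespace PseudoRiem

/-- A (rough) vector field on an `n`-dimensional manifold `Q`. -/
abbrev VField (n : ℕ) (Q : Type*) [TopologicalSpace Q]
    [ChartedSpace (EuclideanSpace ℝ (Fin n)) Q] : Type _ :=
  ∀ x : Q, TangentSpace (𝓡 n) x

/-- Smoothness of a vector field at a point, as a section of the tangent bundle. -/
def VField.SmoothAt {n : ℕ} {Q : Type*} [TopologicalSpace Q]
    [ChartedSpace (EuclideanSpace ℝ (Fin n)) Q] [IsManifold (𝓡 n) ∞ Q]
    (X : VField n Q) (x : Q) : Prop :=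
  ContMDiffAt (𝓡 n) (𝓡 n).tangent ∞ (fun y => (⟨y, X y⟩ : TangentBundle (𝓡 n) Q)) x

/-- Smoothness of a real function near a point. -/
def FunSmoothAt (n : ℕ) {Q : Type*} [TopologicalSpace Q]
    [ChartedSpace (EuclideanSpace ℝ (Fin n)) Q] (f : Q → ℝ) (x : Q) : Prop :=
  ContMDiffAt (𝓡 n) 𝓘(ℝ, ℝ) ∞ f x

/-- The differential `df_x` of a real function, a covector at `x`. -/
def diff (n : ℕ) {Q : Type*} [TopologicalSpace Q]
    [ChartedSpace (EuclideanSpace ℝ (Fin n)) Q] (f : Q → ℝ) (x : Q) :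
    TangentSpace (𝓡 n) x →L[ℝ] ℝ :=
  mvfderiv (𝓡 n) f x

/-- The derivative `X f = df(X)` of a function along a vector field. -/
def VField.deriv {n : ℕ} {Q : Type*} [TopologicalSpace Q]
    [ChartedSpace (EuclideanSpace ℝ (Fin n)) Q] (X : VField n Q) (f : Q → ℝ) : Q → ℝ :=
  fun x => diff n f x (X x)

/-- A smooth symmetric contravariant 2-tensor field `K = (K^{ij})`. At each point it is recorded as
the linear map `α ↦ K^{ij} α_j` from covectors to vectors, so that `K(α, β) = α (K β)`. It is smooth
when `K(df, dh)` is smooth for all smooth `f`, `h` (for coordinate functions these are the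
components of `K`). -/
structure SymTensor (n : ℕ) (Q : Type*) [TopologicalSpace Q]
    [ChartedSpace (EuclideanSpace ℝ (Fin n)) Q] where
  /-- the map `α ↦ K^{ij} α_j` -/
  sharp : ∀ x : Q, (TangentSpace (𝓡 n) x →L[ℝ] ℝ) →ₗ[ℝ] TangentSpace (𝓡 n) x
  symm : ∀ (x : Q) (α β : TangentSpace (𝓡 n) x →L[ℝ] ℝ), α (sharp x β) = β (sharp x α)
  smooth : ∀ (f h : Q → ℝ) (x : Q), FunSmoothAt n f x → FunSmoothAt n h x →
    FunSmoothAt n (fun y => diff n f y (sharp y (diff n h y))) x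

/-- A contravariant pseudo-Riemannian metric of arbitrary signature: a nondegenerate smooth
symmetric contravariant 2-tensor field. -/
structure Metric (n : ℕ) (Q : Type*) [TopologicalSpace Q]
    [ChartedSpace (EuclideanSpace ℝ (Fin n)) Q] extends SymTensor n Q where
  nondegenerate : ∀ x : Q, Function.Bijective (sharp x)

section

variable {n : ℕ} {Q : Type*} [TopologicalSpace Q] [ChartedSpace (EuclideanSpace ℝ (Fin n)) Q]

/-- The function `K(df, dh)`. -/
def SymTensor.onDiff (K : SymTensor n Q) (f h : Q → ℝ) : Q → ℝ :=
  fun x => diff n f x (K.sharp x (diff n h x))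

/-- The Lie derivative `𝓛_X K` of a contravariant tensor, evaluated on `(df, dh)`; recall that
`𝓛_X df = d(X f)`, so that this is the Leibniz rule
`(𝓛_X K)(df, dh) = X (K(df, dh)) - K(𝓛_X df, dh) - K(df, 𝓛_X dh)`. -/
def SymTensor.lie (X : VField n Q) (K : SymTensor n Q) (f h : Q → ℝ) : Q → ℝ :=
  fun x => X.deriv (K.onDiff f h) x - K.onDiff (X.deriv f) h x - K.onDiff f (X.deriv h) x

/-- The Lie-Schouten bracket `[K, G]` of two symmetric contravariant 2-tensors, evaluated on
`(df, df, df)` (a symmetric 3-tensor is determined by these values). In coordinates it is the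
symmetric tensor of the fibrewise cubic polynomial
`{K^{ij}p_ip_j, G^{ij}p_ip_j} = 2 (K^{li} ∂_l G^{jk} - G^{li} ∂_l K^{jk}) p_i p_j p_k`
on the cotangent bundle. At `p = df` it equals
`2 (K(df, d(G(df, df))) - G(df, d(K(df, df))))`, because the terms with second derivatives of `f`
in the two summands are equal and cancel. -/
def SymTensor.schouten (K G : SymTensor n Q) (f : Q → ℝ) : Q → ℝ :=
  fun x => 2 * (K.onDiff f (G.onDiff f f) x - G.onDiff f (K.onDiff f f) x)

/-- The mixed tensor `(L^i_j) = (L^{ik} g_{kj})` of `L`, an endomorphism of each tangent space. -/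
def Metric.mixed (G : Metric n Q) (L : SymTensor n Q) (x : Q) :
    TangentSpace (𝓡 n) x →ₗ[ℝ] TangentSpace (𝓡 n) x :=
  L.sharp x ∘ₗ (LinearEquiv.ofBijective (G.sharp x) (G.nondegenerate x)).symm.toLinearMap

/-- The endomorphism `A` of the tangent space `T_x Q` has simple eigenvalues: its characteristic
polynomial has no multiple root (over `ℂ`). -/
def SimpleEigenvalues {x : Q}
    (A : TangentSpace (𝓡 n) x →ₗ[ℝ] TangentSpace (𝓡 n) x) : Prop :=
  haveI : Module.Finite ℝ (TangentSpace (𝓡 n) x) :=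
    inferInstanceAs (Module.Finite ℝ (EuclideanSpace ℝ (Fin n)))
  A.charpoly.Separable

variable [IsManifold (𝓡 n) ∞ Q]

/-- `X` is a conformal Killing vector with `𝓛_X G = F G`. -/
def Metric.IsCKVWith (G : Metric n Q) (X : VField n Q) (F : Q → ℝ) : Prop :=
  (∀ x, X.SmoothAt x) ∧
    ∀ (x : Q) (f h : Q → ℝ), FunSmoothAt n f x → FunSmoothAt n h x →
      G.toSymTensor.lie X f h x = F x * G.onDiff f h x

/-- A proper conformal Killing vector: `𝓛_X G = F G` with `F` not the zero function. -/
def Metric.IsProperCKV (G : Metric n Q) (X : VField n Q) : Prop :=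
  ∃ F : Q → ℝ, F ≠ 0 ∧ G.IsCKVWith X F

/-- `K` is a conformal Killing tensor: `[K, G] = 2 C ⊙ G` for some vector field `C`. -/
def Metric.IsCKT (G : Metric n Q) (K : SymTensor n Q) : Prop :=
  ∃ C : VField n Q, (∀ x, C.SmoothAt x) ∧
    ∀ (x : Q) (f : Q → ℝ), FunSmoothAt n f x →
      K.schouten G.toSymTensor f x = 2 * (C.deriv f x * G.onDiff f f x)

/-- The Nijenhuis torsion of a field of endomorphisms `A` of the tangent spaces:
`N_A(Y, Z) = [AY, AZ] - A [AY, Z] - A [Y, AZ] + A² [Y, Z]`. -/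
def nijenhuis (A : ∀ x : Q, TangentSpace (𝓡 n) x →ₗ[ℝ] TangentSpace (𝓡 n) x)
    (Y Z : VField n Q) : VField n Q := fun x =>
  VectorField.mlieBracket (𝓡 n) (fun y => A y (Y y)) (fun y => A y (Z y)) x
    - A x (VectorField.mlieBracket (𝓡 n) (fun y => A y (Y y)) Z x)
    - A x (VectorField.mlieBracket (𝓡 n) Y (fun y => A y (Z y)) x)
    + A x (A x (VectorField.mlieBracket (𝓡 n) Y Z x))

/-- An L-tensor: a conformal Killing tensor with (pointwise) simple eigenvalues and vanishing
Nijenhuis torsion. -/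
structure Metric.IsLTensor (G : Metric n Q) (L : SymTensor n Q) : Prop where
  isCKT : G.IsCKT L
  simple : ∀ x : Q, SimpleEigenvalues (G.mixed L x)
  torsion : ∀ (Y Z : VField n Q) (x : Q), Y.SmoothAt x → Z.SmoothAt x →
    nijenhuis (G.mixed L) Y Z x = 0

end

/-- `E` is a field of eigenvectors of the field of endomorphisms `A`. -/
def IsEigenvectorField {n : ℕ} {Q : Type*} [TopologicalSpace Q]
    [ChartedSpace (EuclideanSpace ℝ (Fin n)) Q]
    (A : ∀ x : Q, TangentSpace (𝓡 n) x →ₗ[ℝ] TangentSpace (𝓡 n) x) (E : VField n Q) : Prop :=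
  ∀ x, ∃ u : ℝ, Module.End.HasEigenvector (A x) u (E x)

end PseudoRiem

end

noncomputable section

namespace PseudoRiem

open Module Filter Topology

/-! ### Linear algebra at a single point. -/

section LinearAlgebra

variable {V : Type*} [AddCommGroup V] [Module ℝ V] [FiniteDimensional ℝ V]

/-! The claim is pointwise. Work in a chart at one point, with `A` the mixed tensor, `S`, `T`, `N`
the derivatives of `G`, `A`, `X`, and `F` the conformal factor there.

If `X` vanishes at the point, the conformal equation becomes `N G + G Nᵀ = -F G`, so `F ≠ 0` forces
`N` to have rank at least `n / 2` (`finrank_le_two_mul_finrank_range`). But every `N v` is a limit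
of multiples of eigenvectors, hence satisfies the eigenvector equation
(`exists_eigenvalue_fderiv_apply`), and with simple eigenvalues such vectors fill at most a line
(`finrank_le_one_of_forall_eigenvector`). This contradicts `n > 2`.

If `X` is nonzero, its eigenvalue `u` is differentiable near the point. Vanishing torsion shows that
`du ∘ A = u du`, that the Lie derivative of `A` along `X` has image in `ℝ X`
(`deriv_eigenvalue_and_lie_of_torsion`), and that the covector `ξ = G⁻¹ X` has `dξ = 0` on the
orthogonal complement of `X` (`exterior_deriv_eq_zero`). For `α` with `α X = 0`, the part of the
conformal Killing tensor equation that is linear in `ξ` and quadratic in `α` then collapses to `F (u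
G - L)(α, α) = ξ(C) G(α, α)`. So `F ≠ 0` would make `A` scalar on the complement of `X`, of
dimension `n - 1 ≥ 2`, against simplicity (`conformal_factor_eq_zero`). -/

lemma finrank_maxGenEigenspace_le_one {A : V →ₗ[ℝ] V} (hA : A.charpoly.Separable) (u : ℝ) :
    finrank ℝ (End.maxGenEigenspace A u) ≤ 1 := by
  rw [LinearMap.finrank_maxGenEigenspace_eq]
  exact Polynomial.rootMultiplicity_le_one_of_separable hA u

lemma eq_smul_of_mem_maxGenEigenspace {A : V →ₗ[ℝ] V} (hA : A.charpoly.Separable) {u : ℝ} {X Y : V}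
    (hX : A X = u • X) (hX0 : X ≠ 0) (hY : Y ∈ End.maxGenEigenspace A u) : ∃ c : ℝ, Y = c • X := by
  have hXm : X ∈ End.maxGenEigenspace A u := by
    rw [End.mem_maxGenEigenspace]
    exact ⟨1, by simp [hX]⟩
  obtain ⟨v, hv⟩ := finrank_le_one_iff.1 (finrank_maxGenEigenspace_le_one hA u)
  obtain ⟨a, ha⟩ := hv ⟨X, hXm⟩
  obtain ⟨b, hb⟩ := hv ⟨Y, hY⟩
  have ha' : a • (v : V) = X := congrArg Subtype.val ha
  have hb' : b • (v : V) = Y := congrArg Subtype.val hb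
  have ha0 : a ≠ 0 := by
    rintro rfl
    exact hX0 (by rw [← ha', zero_smul])
  exact ⟨b / a, by rw [← ha', ← hb', smul_smul, div_mul_cancel₀ _ ha0]⟩

lemma eq_smul_of_apply_eq_smul {A : V →ₗ[ℝ] V} (hA : A.charpoly.Separable) {u : ℝ} {X Y : V}
    (hX : A X = u • X) (hX0 : X ≠ 0) (hY : A Y = u • Y) : ∃ c : ℝ, Y = c • X := by
  refine eq_smul_of_mem_maxGenEigenspace hA hX hX0 ?_
  rw [End.mem_maxGenEigenspace]
  exact ⟨1, by simp [hY]⟩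

/-- Simple eigenvalues exclude Jordan blocks: `Y` lies in the generalized eigenspace, which is the
line `ℝ X`, and `A - u` is zero on it. -/
lemma eq_zero_of_sub_smul_eq_smul {A : V →ₗ[ℝ] V} (hA : A.charpoly.Separable) {u : ℝ} {X : V}
    (hX : A X = u • X) (hX0 : X ≠ 0) {Y : V} {c : ℝ} (hY : A Y - u • Y = c • X) : c = 0 := by
  have hm : Y ∈ End.maxGenEigenspace A u := by
    rw [End.mem_maxGenEigenspace]
    refine ⟨2, ?_⟩
    have h : (A - u • (1 : End ℝ V)) Y = c • X := by simpa using hY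
    rw [pow_two, Module.End.mul_apply, h]
    simp [hX]
  obtain ⟨b, rfl⟩ := eq_smul_of_mem_maxGenEigenspace hA hX hX0 hm
  have : c • X = 0 := by rw [← hY, map_smul, hX, smul_comm, sub_self]
  exact (smul_eq_zero.1 this).resolve_right hX0

/-- A subspace of eigenvectors of an endomorphism with simple eigenvalues is at most a line. -/
lemma finrank_le_one_of_forall_eigenvector {A : V →ₗ[ℝ] V} (hA : A.charpoly.Separable)
    (R : Submodule ℝ V) (hR : ∀ w ∈ R, ∃ u : ℝ, A w = u • w) : finrank ℝ R ≤ 1 := by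
  by_cases h0 : ∃ w ∈ R, w ≠ 0
  · obtain ⟨w, hw, hw0⟩ := h0
    obtain ⟨u, hu⟩ := hR w hw
    refine finrank_le_one_iff.2 ⟨⟨w, hw⟩, fun y => ?_⟩
    obtain ⟨c, hc⟩ : ∃ c : ℝ, (y : V) = c • w := by
      obtain ⟨a, ha⟩ := hR y y.2
      obtain ⟨b, hb⟩ := hR (w + y) (R.add_mem hw y.2)
      rw [map_add, hu, ha] at hb
      have h1 : (a - b) • (y : V) = (b - u) • w := by
        linear_combination (norm := module) hb
      by_cases hab : a = b
      · have h2 : (b - u) • w = 0 := by rw [← h1, hab, sub_self, zero_smul]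
        have h3 : b = u := sub_eq_zero.1 ((smul_eq_zero.1 h2).resolve_right hw0)
        exact eq_smul_of_apply_eq_smul hA hu hw0 (by rw [ha, hab, h3])
      · refine ⟨(a - b)⁻¹ * (b - u), ?_⟩
        rw [mul_smul, ← h1, smul_smul, inv_mul_cancel₀ (sub_ne_zero.2 hab), one_smul]
    exact ⟨c, Subtype.ext hc.symm⟩
  · have : R = ⊥ := by
      rw [eq_bot_iff]
      intro w hw
      by_contra hw0
      exact h0 ⟨w, hw, hw0⟩
    rw [this]
    simp

/-- If `N G + G Nᵀ = -F G` with `F ≠ 0`, then `N` has rank at least half the dimension. -/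
lemma finrank_le_two_mul_finrank_range {G : Dual ℝ V →ₗ[ℝ] V} (hG : Function.Injective G)
    {N : V →ₗ[ℝ] V} {F : ℝ} (hF : F ≠ 0)
    (hN : ∀ α β : Dual ℝ V, - α (N (G β)) - β (N (G α)) = F * β (G α)) :
    finrank ℝ V ≤ 2 * finrank ℝ (LinearMap.range N) := by
  set R := LinearMap.range N
  -- For `α` vanishing on `R`, one term of `hN` drops out and `N (G α) = -F G α`; hence `G α ∈ R`.
  -- Comparing dimensions, `n - r ≤ r`.
  have hle : R.dualAnnihilator.map G ≤ R := by
    rintro _ ⟨α, hα, rfl⟩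
    have hα' := (Submodule.mem_dualAnnihilator α).1 hα
    have key : N (G α) = (-F) • G α := by
      rw [← sub_eq_zero, ← Module.forall_dual_apply_eq_zero_iff ℝ]
      intro β
      have h1 := hN α β
      rw [hα' (N (G β)) ⟨_, rfl⟩] at h1
      simp only [map_sub, map_smul, smul_eq_mul]
      linarith
    have : G α = N ((-F)⁻¹ • G α) := by
      rw [map_smul, key, smul_smul, inv_mul_cancel₀ (neg_ne_zero.2 hF), one_smul]
    rw [this]
    exact ⟨_, rfl⟩
  have h1 := Submodule.finrank_mono hle
  rw [← (Submodule.equivMapOfInjective G hG R.dualAnnihilator).finrank_eq] at h1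
  have h2 := Subspace.finrank_add_finrank_dualAnnihilator_eq R
  omega

variable {G : Dual ℝ V →ₗ[ℝ] V} {A : V →ₗ[ℝ] V} {S : V →ₗ[ℝ] Dual ℝ V →ₗ[ℝ] V}
  {T : V →ₗ[ℝ] V →ₗ[ℝ] V} {N : V →ₗ[ℝ] V} {d : V →ₗ[ℝ] ℝ} {X C : V} {u F : ℝ}

/-- `hd` is the derivative of `A X = u X`, and `hT` is the torsion on constant vectors. Taking `Y =
X`, the Lie derivative `(𝓛_X A) Z` is sent by `A - u` to a multiple of `X`. The absence of Jordan
blocks kills that multiple, which is the first claim; then `(𝓛_X A) Z` lies in the eigenline. -/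
lemma deriv_eigenvalue_and_lie_of_torsion (hA : A.charpoly.Separable) (hAX : A X = u • X)
    (hX0 : X ≠ 0) (hT : ∀ Y Z, T (A Y) Z - T (A Z) Y + A (T Z Y) - A (T Y Z) = 0)
    (hd : ∀ v, T v X + A (N v) = d v • X + u • N v) (Z : V) :
    d (A Z) = u * d Z ∧ ∃ θ : ℝ, T X Z = N (A Z) - A (N Z) + θ • X := by
  have h1 : T (A Z) X = d (A Z) • X + u • N (A Z) - A (N (A Z)) := eq_sub_of_add_eq (hd _)
  have h2 : T Z X = d Z • X + u • N Z - A (N Z) := eq_sub_of_add_eq (hd _)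
  have h3 := hT X Z
  rw [hAX, h1, h2] at h3
  simp only [map_sub, map_add, map_smul, LinearMap.smul_apply, hAX] at h3
  have key : A (T X Z - N (A Z) + A (N Z)) - u • (T X Z - N (A Z) + A (N Z))
      = (u * d Z - d (A Z)) • X := by
    simp only [map_sub, map_add]
    linear_combination (norm := module) - h3
  have h0 := eq_zero_of_sub_smul_eq_smul hA hAX hX0 key
  refine ⟨by linarith, ?_⟩
  rw [h0, zero_smul, sub_eq_zero] at key
  obtain ⟨θ, hθ⟩ := eq_smul_of_apply_eq_smul hA hAX hX0 key
  exact ⟨θ, by linear_combination (norm := module) hθ⟩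

/-- The range of the transpose of `A - u` is the annihilator of its kernel, and that kernel is `ℝ
X`. -/
lemma exists_eq_comp_sub (hA : A.charpoly.Separable) (hAX : A X = u • X) (hX0 : X ≠ 0)
    {α : Dual ℝ V} (hα : α X = 0) : ∃ γ : Dual ℝ V, ∀ w, α w = γ (A w) - u * γ w := by
  have h : α ∈ (LinearMap.ker (A - u • LinearMap.id)).dualAnnihilator := by
    rw [Submodule.mem_dualAnnihilator]
    intro w hw
    obtain ⟨c, rfl⟩ := eq_smul_of_apply_eq_smul hA hAX hX0
      (sub_eq_zero.1 (by simpa using hw : A w - u • w = 0))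
    simp [hα]
  rw [← LinearMap.range_dualMap_eq_dualAnnihilator_ker] at h
  obtain ⟨γ, rfl⟩ := h
  exact ⟨γ, fun w => by simp⟩

/-- The differential of the covector field dual to an eigenvector field vanishes on the complementary
invariant subspace. -/
lemma exterior_deriv_eq_zero (hA : A.charpoly.Separable) (hAX : A X = u • X) (hX0 : X ≠ 0)
    (hG : Function.Surjective G) (hGs : ∀ α β : Dual ℝ V, α (G β) = β (G α))
    (hLs : ∀ α β : Dual ℝ V, α (A (G β)) = β (A (G α)))
    (hSs : ∀ (v : V) (α β : Dual ℝ V), α (S v β) = β (S v α))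
    (hMs : ∀ (v : V) (α β : Dual ℝ V), α (T v (G β)) + α (A (S v β)) =
      β (T v (G α)) + β (A (S v α)))
    (hT : ∀ Y Z, T (A Y) Z - T (A Z) Y + A (T Z Y) - A (T Y Z) = 0)
    (hd : ∀ v, T v X + A (N v) = d v • X + u • N v) {ξ : Dual ℝ V} (hξ : G ξ = X)
    {α β : Dual ℝ V} (hα : α X = 0) (hβ : β X = 0) :
    α (N (G β) - S (G β) ξ) = β (N (G α) - S (G α) ξ) := by
  -- `A` is self-adjoint for the metric, so the covector dual to `X` is an eigenvector of the
  -- transpose.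
  have hξA (w : V) : ξ (A w) = u * ξ w := by
    obtain ⟨γ, rfl⟩ := hG w
    rw [hLs, hξ, hAX, map_smul, smul_eq_mul, hGs ξ, hξ]
  have hξT (v : V) (γ : Dual ℝ V) :
      ξ (T v (G γ)) = d v * ξ (G γ) - γ (A (N v - S v ξ)) + u * γ (N v - S v ξ) := by
    have h1 := hMs v ξ γ
    rw [hξ, hξA, hSs v ξ γ] at h1
    have h2 := congrArg γ (hd v)
    have h3 : ξ (G γ) = γ X := by rw [hGs, hξ]
    simp only [map_add, map_sub, map_smul, smul_eq_mul] at h2 ⊢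
    rw [h3]
    linarith
  have hGsub {α a : Dual ℝ V} (ha : ∀ w, α w = a (A w) - u * a w) : G α = A (G a) - u • G a := by
    rw [← sub_eq_zero, ← Module.forall_dual_apply_eq_zero_iff ℝ]
    intro γ
    simp only [map_sub, map_smul, smul_eq_mul]
    rw [hGs γ α, ha, hLs a γ, hGs a γ, sub_self]
  obtain ⟨a, ha⟩ := exists_eq_comp_sub hA hAX hX0 hα
  obtain ⟨b, hb⟩ := exists_eq_comp_sub hA hAX hX0 hβ
  -- Since `G α` and `G β` are the images of `G a` and `G b` under `A - u`, the `ξ`-component of the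
  -- torsion on `G b`, `G a` is `dξ` on `G α`, `G β` up to sign; the `d` terms cancel by `du ∘ A = u
  -- du`.
  have h1 := congrArg ξ (hT (G b) (G a))
  simp only [map_add, map_sub, map_zero, hξA] at h1
  rw [hξT, hξT, hξT, hξT, (deriv_eigenvalue_and_lie_of_torsion hA hAX hX0 hT hd (G b)).1,
    (deriv_eigenvalue_and_lie_of_torsion hA hAX hX0 hT hd (G a)).1] at h1
  rw [ha, hb, hGsub ha, hGsub hb]
  simp only [map_sub, map_smul, smul_eq_mul, LinearMap.sub_apply, LinearMap.smul_apply]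
    at h1 ⊢
  linear_combination -h1

/-- A conformal Killing vector which is a nonzero eigenvector of an L-tensor is Killing, in terms of
the values and the first derivatives at a point: `S`, `T`, `N`, `d` are the derivatives of the metric
`G`, the endomorphism `A`, the vector field `X` and the eigenvalue `u`. -/
lemma conformal_factor_eq_zero (hn : 2 < finrank ℝ V) (hA : A.charpoly.Separable)
    (hAX : A X = u • X) (hX0 : X ≠ 0) (hG : Function.Bijective G)
    (hGs : ∀ α β : Dual ℝ V, α (G β) = β (G α)) (hLs : ∀ α β : Dual ℝ V, α (A (G β)) = β (A (G α)))
    (hSs : ∀ (v : V) (α β : Dual ℝ V), α (S v β) = β (S v α))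
    (hMs : ∀ (v : V) (α β : Dual ℝ V), α (T v (G β)) + α (A (S v β)) =
      β (T v (G α)) + β (A (S v α)))
    (hT : ∀ Y Z, T (A Y) Z - T (A Z) Y + A (T Z Y) - A (T Y Z) = 0)
    (hd : ∀ v, T v X + A (N v) = d v • X + u • N v)
    (hCKV : ∀ α β : Dual ℝ V, β (S X α) - α (N (G β)) - β (N (G α)) = F * β (G α))
    (hCKT : ∀ p : Dual ℝ V, p (S (A (G p)) p) - (p (T (G p) (G p)) + p (A (S (G p) p))) =
      p C * p (G p)) : F = 0 := by
  obtain ⟨ξ, hξ⟩ := hG.2 X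
  have hGA (α : Dual ℝ V) : G (α ∘ₗ A) = A (G α) := by
    rw [← sub_eq_zero, ← Module.forall_dual_apply_eq_zero_iff ℝ]
    intro γ
    rw [map_sub, hGs, LinearMap.comp_apply, hLs α γ, sub_self]
  have hξG (α : Dual ℝ V) : ξ (G α) = α X := by rw [hGs, hξ]
  -- `X` is not null: otherwise `ξ = γ ∘ (A - u)` for some `γ`, so `X = (A - u) (G γ)` would start a
  -- Jordan block.
  have hξX : ξ X ≠ 0 := by
    intro h
    obtain ⟨γ, hγ⟩ := exists_eq_comp_sub hA hAX hX0 h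
    have h1 : A (G γ) - u • G γ = (1 : ℝ) • X := by
      rw [← sub_eq_zero, ← Module.forall_dual_apply_eq_zero_iff ℝ]
      intro β
      simp only [map_sub, map_smul, smul_eq_mul, ← hξ]
      rw [hGs β ξ, hγ, hLs γ β, hGs γ β]
      ring
    exact one_ne_zero (eq_zero_of_sub_smul_eq_smul hA hAX hX0 h1)
  have hquad (α : Dual ℝ V) (hα : α X = 0) :
      F * (u * α (G α) - α (A (G α))) = ξ C * α (G α) := by
    have hα' : (α ∘ₗ A) X = 0 := by simp [hAX, hα]
    have hdξ := exterior_deriv_eq_zero hA hAX hX0 hG.2 hGs hLs hSs hMs hT hd hξ hα hα'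
    obtain ⟨θ, hθ⟩ := (deriv_eigenvalue_and_lie_of_torsion hA hAX hX0 hT hd (G α)).2
    have hTX := congrArg α hθ
    have hdα := congrArg α (hd (G α))
    have hM := hMs (G α) ξ α
    have hc1 := hCKV α α
    have hc2 := hCKV α (α ∘ₗ A)
    -- The combination `(h1 + h2) / 2 - h3` isolates the terms of the cubic identity that are linear
    -- in `ξ` and quadratic in `α`.
    have h1 := hCKT (ξ + α)
    have h2 := hCKT (ξ - α)
    have h3 := hCKT ξ
    have hs1 := hSs X ξ α
    have hs2 := hSs (A (G α)) ξ α
    rw [hGA] at hc2 hdξ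
    simp only [map_add, map_sub, map_smul, smul_eq_mul, LinearMap.add_apply, LinearMap.sub_apply,
      LinearMap.smul_apply, LinearMap.comp_apply, hξ, hAX, hξG, hα, mul_zero]
      at hdξ hTX hdα hM hc1 hc2 h1 h2 h3 hs1 hs2 ⊢
    linear_combination (h1 + h2) / 2 - h3 - u * hc1 + hc2 + hM + hTX + 2 * hdα + 2 * hdξ - hs2
  have hpol (α β : Dual ℝ V) (hα : α X = 0) (hβ : β X = 0) :
      F * (u * α (G β) - α (A (G β))) = ξ C * α (G β) := by
    have h1 := hquad (α + β) (by simp [hα, hβ])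
    have h2 := hquad α hα
    have h3 := hquad β hβ
    simp only [map_add, LinearMap.add_apply] at h1
    rw [hGs β α, hLs β α] at h1
    linarith
  by_contra hF
  let W := (Submodule.span ℝ {X}).dualAnnihilator
  have hW {α : Dual ℝ V} : α ∈ W ↔ α X = 0 := by
    rw [Submodule.mem_dualAnnihilator]
    refine ⟨fun h => h X (Submodule.mem_span_singleton_self X), fun h w hw => ?_⟩
    obtain ⟨c, rfl⟩ := Submodule.mem_span_singleton.1 hw
    simp [h]
  have hscal (β : Dual ℝ V) (hβ : β X = 0) : A (G β) = (u - ξ C / F) • G β := by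
    -- All covectors killing `X` kill this vector, so it is a multiple of `X`; pairing with `ξ` then
    -- shows that it is zero, because `ξ X ≠ 0`.
    have hmem : F • (u • G β - A (G β)) - ξ C • G β ∈ Submodule.span ℝ {X} := by
      rw [← Subspace.forall_mem_dualAnnihilator_apply_eq_zero_iff]
      intro α hα
      simp only [map_sub, map_smul, smul_eq_mul]
      rw [hpol α β (hW.1 hα) hβ, sub_self]
    obtain ⟨c, hc⟩ := Submodule.mem_span_singleton.1 hmem
    have hc0 : c = 0 := by
      have := congrArg ξ hc
      simp only [map_sub, map_smul, smul_eq_mul, hξG, hβ] at this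
      rw [hLs ξ β, hξ, hAX, map_smul, hβ] at this
      simpa [hξX] using this
    rw [hc0, zero_smul] at hc
    have h2 : A (G β) = F⁻¹ • (F • A (G β)) := by rw [smul_smul, inv_mul_cancel₀ hF, one_smul]
    have h3 : F • A (G β) = (F * u - ξ C) • G β := by linear_combination (norm := module) hc
    rw [h2, h3, smul_smul]
    congr 1
    field_simp
  have hle := finrank_le_one_of_forall_eigenvector hA (W.map G) (by
    rintro _ ⟨β, hβ, rfl⟩
    exact ⟨_, hscal β (hW.1 hβ)⟩)
  rw [← (Submodule.equivMapOfInjective G hG.1 W).finrank_eq] at hle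
  have h2 : finrank ℝ (Submodule.span ℝ {X}) + finrank ℝ W = finrank ℝ V :=
    Subspace.finrank_add_finrank_dualAnnihilator_eq _
  rw [finrank_span_singleton hX0] at h2
  omega

end LinearAlgebra

/-! ### Calculus in a vector space: from fields to their first derivatives at a point. -/

section Flat

variable {V : Type*} [NormedAddCommGroup V] [NormedSpace ℝ V]

lemma differentiableAt_clm_of_apply [FiniteDimensional ℝ V] {D W : Type*} [NormedAddCommGroup D]
    [NormedSpace ℝ D] [NormedAddCommGroup W] [NormedSpace ℝ W] {f : D → V →L[ℝ] W} {z : D}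
    (h : ∀ v, DifferentiableAt ℝ (fun y => f y v) z) : DifferentiableAt ℝ f z := by
  let e : (V →L[ℝ] W) ≃L[ℝ] Fin (finrank ℝ V) → W :=
    ((ContinuousLinearEquiv.ofFinrankEq (finrank_fin_fun ℝ).symm).arrowCongr
      (1 : W ≃L[ℝ] W)).trans (ContinuousLinearEquiv.piRing _)
  rw [← e.comp_differentiableAt_iff]
  exact differentiableAt_pi.2 fun i => h _

lemma differentiableAt_clm_inverse {D U W : Type*} [NormedAddCommGroup D] [NormedSpace ℝ D]
    [NormedAddCommGroup U] [NormedSpace ℝ U] [CompleteSpace U] [NormedAddCommGroup W]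
    [NormedSpace ℝ W] {f : D → U →L[ℝ] W} {z : D} (hf : DifferentiableAt ℝ f z)
    (hinv : (f z).IsInvertible) : DifferentiableAt ℝ (fun y => (f y).inverse) z := by
  have h : DifferentiableAt ℝ ContinuousLinearMap.inverse (f z) :=
    hinv.contDiffAt_map_inverse (n := 1) |>.differentiableAt one_ne_zero
  exact h.comp z hf

lemma fderiv_clm_apply_const {D W U : Type*} [NormedAddCommGroup D] [NormedSpace ℝ D]
    [NormedAddCommGroup W] [NormedSpace ℝ W] [NormedAddCommGroup U] [NormedSpace ℝ U]
    {f : D → U →L[ℝ] W} {z : D} (hf : DifferentiableAt ℝ f z) (α : W →L[ℝ] ℝ) (w : U) (v : D) :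
    fderiv ℝ (fun y => α (f y w)) z v = α (fderiv ℝ f z v w) := by
  have h1 : HasFDerivAt (fun y => f y w) ((ContinuousLinearMap.apply ℝ W w) ∘L fderiv ℝ f z) z :=
    ((ContinuousLinearMap.apply ℝ W w).hasFDerivAt (x := f z)).comp z hf.hasFDerivAt
  have h2 := (α.hasFDerivAt (x := f z w)).comp z h1
  have h3 : fderiv ℝ (fun y => α (f y w)) z = _ := h2.fderiv
  rw [h3]
  rfl

lemma fderiv_clm_comp_apply {D U W W' : Type*} [NormedAddCommGroup D] [NormedSpace ℝ D]
    [NormedAddCommGroup W] [NormedSpace ℝ W] [NormedAddCommGroup U] [NormedSpace ℝ U]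
    [NormedAddCommGroup W'] [NormedSpace ℝ W'] {f : D → W →L[ℝ] W'} {g : D → U →L[ℝ] W} {z : D}
    (hf : DifferentiableAt ℝ f z) (hg : DifferentiableAt ℝ g z) (v : D) (w : U) :
    fderiv ℝ (fun y => f y ∘L g y) z v w = fderiv ℝ f z v (g z w) + f z (fderiv ℝ g z v w) := by
  rw [fderiv_clm_comp hf hg]
  simp [add_comm]

/-- At a zero of a vector field which is everywhere an eigenvector of `A`, the range of its
derivative consists of eigenvectors of `A`. -/
lemma exists_eigenvalue_fderiv_apply {A : V → V →L[ℝ] V} {X : V → V} {z : V}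
    (hA : ContinuousAt A z) (hX : DifferentiableAt ℝ X z) (hX0 : X z = 0)
    (hAX : ∀ᶠ y in 𝓝 z, ∃ u : ℝ, A y (X y) = u • X y) (v : V) :
    ∃ u : ℝ, A z (fderiv ℝ X z v) = u • fderiv ℝ X z v := by
  set w := fderiv ℝ X z v
  have hlim : Tendsto (fun t : ℝ => t⁻¹ • X (z + t • v)) (𝓝[≠] 0) (𝓝 w) := by
    have h1 : HasDerivAt (fun t : ℝ => X (z + t • v)) w 0 := by
      have h2 : HasDerivAt (fun t : ℝ => z + t • v) v 0 := by
        simpa using ((hasDerivAt_id (0 : ℝ)).smul_const v).const_add z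
      have h3 : HasFDerivAt X (fderiv ℝ X z) (z + (0 : ℝ) • v) := by
        simpa using hX.hasFDerivAt
      exact h3.comp_hasDerivAt 0 h2
    simpa [hX0] using h1.tendsto_slope_zero
  have hline : Tendsto (fun t : ℝ => z + t • v) (𝓝[≠] 0) (𝓝 z) := by
    have : ContinuousAt (fun t : ℝ => z + t • v) 0 := by fun_prop
    have h := this.tendsto
    simp only [zero_smul, add_zero] at h
    exact h.mono_left nhdsWithin_le_nhds
  have hAlim : Tendsto (fun t : ℝ => A (z + t • v) (t⁻¹ • X (z + t • v))) (𝓝[≠] 0) (𝓝 (A z w)) :=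
    (isBoundedBilinearMap_apply.continuous.tendsto (A z, w)).comp
      ((hA.tendsto.comp hline).prodMk_nhds hlim)
  -- The eigenvalues along the line need not be known to converge. Parallelism of `A X` and `X`,
  -- written as the vanishing of 2×2 minors, is a closed condition and passes to the limit.
  have hdep (α β : V →L[ℝ] ℝ) : α (A z w) * β w = β (A z w) * α w := by
    have h1 := ((α.continuous.tendsto _).comp hAlim).mul ((β.continuous.tendsto _).comp hlim)
    have h2 := ((β.continuous.tendsto _).comp hAlim).mul ((α.continuous.tendsto _).comp hlim)
    refine tendsto_nhds_unique (h1.congr' ?_) h2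
    filter_upwards [hline.eventually hAX] with t ht
    obtain ⟨u, hu⟩ := ht
    simp only [Function.comp_apply, map_smul, hu, smul_eq_mul]
    ring
  by_cases hw : w = 0
  · exact ⟨0, by rw [hw]; simp⟩
  obtain ⟨β, hβ⟩ := SeparatingDual.exists_eq_one (R := ℝ) hw
  refine ⟨β (A z w), ?_⟩
  rw [← sub_eq_zero]
  by_contra hne
  obtain ⟨α, hα⟩ := SeparatingDual.exists_eq_one (R := ℝ) hne
  have := hdep α β
  rw [hβ, mul_one] at this
  rw [map_sub, map_smul, smul_eq_mul, this, sub_self] at hα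
  exact zero_ne_one hα

/-- No regularity of the eigenvalue is assumed. Where `β X ≠ 0` it equals the quotient `β (A X) / β
X`, hence is differentiable at `z`, and `A X = u X` can be differentiated. -/
lemma exists_deriv_eigenvalue {A : V → V →L[ℝ] V} {X : V → V} {z : V}
    (hA : DifferentiableAt ℝ A z) (hX : DifferentiableAt ℝ X z) (hX0 : X z ≠ 0)
    (hAX : ∀ᶠ y in 𝓝 z, ∃ u : ℝ, A y (X y) = u • X y) :
    ∃ (u : ℝ) (d : V →L[ℝ] ℝ), A z (X z) = u • X z ∧
      ∀ v, fderiv ℝ A z v (X z) + A z (fderiv ℝ X z v) = d v • X z + u • fderiv ℝ X z v := by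
  obtain ⟨β, hβ⟩ := SeparatingDual.exists_eq_one (R := ℝ) hX0
  have hβX : DifferentiableAt ℝ (fun y => β (X y)) z := β.differentiableAt.comp z hX
  have hAXd : DifferentiableAt ℝ (fun y => A y (X y)) z := hA.clm_apply hX
  have hβ0 : β (X z) ≠ 0 := by rw [hβ]; exact one_ne_zero
  let U : V → ℝ := fun y => β (A y (X y)) / β (X y)
  have hβA : DifferentiableAt ℝ (fun y => β (A y (X y))) z := β.differentiableAt.comp z hAXd
  have hU : DifferentiableAt ℝ U z := by
    have h := hβA.mul (hβX.inv hβ0)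
    exact h
  have hev : (fun y => A y (X y)) =ᶠ[𝓝 z] fun y => U y • X y := by
    filter_upwards [hAX, hβX.continuousAt.eventually_ne hβ0] with y hy hy0
    obtain ⟨u, hu⟩ := hy
    simp only [U, hu, map_smul, smul_eq_mul, mul_div_cancel_right₀ _ hy0]
  refine ⟨U z, fderiv ℝ U z, hev.eq_of_nhds, fun v => ?_⟩
  have h1 := congrArg (fun f : V →L[ℝ] V => f v) (hev.fderiv_eq (𝕜 := ℝ))
  simp only [fderiv_clm_apply hA hX, fderiv_fun_smul hU hX] at h1
  simp at h1
  rw [add_comm, h1, add_comm]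

/-- The pointwise form of the theorem in a chart. -/
theorem conformal_factor_eq_zero_of_chart [FiniteDimensional ℝ V] (hn : 2 < finrank ℝ V)
    {G : V → (V →L[ℝ] ℝ) →L[ℝ] V} {A : V → V →L[ℝ] V} {X : V → V} {z C : V} {F : ℝ}
    (hGd : DifferentiableAt ℝ G z) (hAd : DifferentiableAt ℝ A z) (hXd : DifferentiableAt ℝ X z)
    (hGb : Function.Bijective (G z))
    (hGs : ∀ α β : V →L[ℝ] ℝ, ∀ᶠ y in 𝓝 z, α (G y β) = β (G y α))
    (hLs : ∀ α β : V →L[ℝ] ℝ, ∀ᶠ y in 𝓝 z, α ((A y ∘L G y) β) = β ((A y ∘L G y) α))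
    (hA : (A z : V →ₗ[ℝ] V).charpoly.Separable)
    (hAX : ∀ᶠ y in 𝓝 z, ∃ u : ℝ, A y (X y) = u • X y)
    (hT : ∀ Y Z, fderiv ℝ A z (A z Y) Z - fderiv ℝ A z (A z Z) Y + A z (fderiv ℝ A z Z Y)
      - A z (fderiv ℝ A z Y Z) = 0)
    (hCKV : ∀ α β : V →L[ℝ] ℝ, β (fderiv ℝ G z (X z) α) - α (fderiv ℝ X z (G z β))
      - β (fderiv ℝ X z (G z α)) = F * β (G z α))
    (hCKT : ∀ p : V →L[ℝ] ℝ, p (fderiv ℝ G z (A z (G z p)) p)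
      - p (fderiv ℝ (fun y => A y ∘L G y) z (G z p) p) = p C * p (G z p)) : F = 0 := by
  let J : Dual ℝ V ≃ₗ[ℝ] (V →L[ℝ] ℝ) := LinearMap.toContinuousLinearMap
  let G₀ : Dual ℝ V →ₗ[ℝ] V := (G z : (V →L[ℝ] ℝ) →ₗ[ℝ] V) ∘ₗ J.toLinearMap
  have hG₀ : Function.Bijective G₀ := hGb.comp J.bijective
  by_cases hX0 : X z = 0
  · by_contra hF
    have h1 := finrank_le_two_mul_finrank_range (G := G₀) hG₀.1 (N := (fderiv ℝ X z : V →ₗ[ℝ] V)) hF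
      (fun α β => by
        have h := hCKV (J α) (J β)
        rw [hX0] at h
        simp only [map_zero, _root_.zero_apply, zero_sub] at h
        exact h)
    have h2 := finrank_le_one_of_forall_eigenvector hA
      (LinearMap.range (fderiv ℝ X z : V →ₗ[ℝ] V)) (by
        rintro _ ⟨v, rfl⟩
        exact exists_eigenvalue_fderiv_apply hAd.continuousAt hXd hX0 hAX v)
    omega
  · obtain ⟨u, d, hu, hd⟩ := exists_deriv_eigenvalue hAd hXd hX0 hAX
    let S : V →ₗ[ℝ] Dual ℝ V →ₗ[ℝ] V := LinearMap.mk₂ ℝ (fun v α => fderiv ℝ G z v (J α))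
      (by simp) (by simp) (by simp) (by simp)
    let T : V →ₗ[ℝ] V →ₗ[ℝ] V := LinearMap.mk₂ ℝ (fun v w => fderiv ℝ A z v w)
      (by simp) (by simp) (by simp) (by simp)
    refine conformal_factor_eq_zero (G := G₀) (A := (A z : V →ₗ[ℝ] V)) (S := S) (T := T)
      (N := (fderiv ℝ X z : V →ₗ[ℝ] V)) (d := (d : V →ₗ[ℝ] ℝ)) (X := X z) (C := C) (u := u)
      hn hA hu hX0 hG₀ (fun α β => (hGs (J α) (J β)).self_of_nhds)
      (fun α β => (hLs (J α) (J β)).self_of_nhds) (fun v α β => ?_) (fun v α β => ?_) hT hd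
      (fun α β => hCKV (J α) (J β)) (fun p => ?_)
    · have h := congrArg (fun f => f v) (EventuallyEq.fderiv_eq (𝕜 := ℝ) (hGs (J α) (J β)))
      simp only [fderiv_clm_apply_const hGd] at h
      exact h
    · have h := congrArg (fun f => f v) (EventuallyEq.fderiv_eq (𝕜 := ℝ) (hLs (J α) (J β)))
      simp only [fderiv_clm_apply_const (hAd.clm_comp hGd), fderiv_clm_comp_apply hAd hGd,
        map_add] at h
      exact h
    · have h := hCKT (J p)
      rw [fderiv_clm_comp_apply hAd hGd, map_add] at h
      exact h

end Flat

/-! ### Components of fields and tensors in a chart. -/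

section Chart

variable {n : ℕ} {Q : Type*} [TopologicalSpace Q] [ChartedSpace (EuclideanSpace ℝ (Fin n)) Q]

/-- The derivative at `y` of the preferred chart at `x`. -/
def chartDeriv (n : ℕ) {Q : Type*} [TopologicalSpace Q] [ChartedSpace (EuclideanSpace ℝ (Fin n)) Q]
    (x y : Q) : TangentSpace (𝓡 n) y →L[ℝ] EuclideanSpace ℝ (Fin n) :=
  mfderiv (𝓡 n) 𝓘(ℝ, EuclideanSpace ℝ (Fin n)) (extChartAt (𝓡 n) x) y

/-- The components of a vector field in the preferred chart at `x`. -/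
def VField.inChart (X : VField n Q) (x y : Q) : EuclideanSpace ℝ (Fin n) :=
  chartDeriv n x y (X y)

/-- The components of a contravariant tensor in the preferred chart at `x`. -/
def SymTensor.inChart (K : SymTensor n Q) (x y : Q) :
    (EuclideanSpace ℝ (Fin n) →L[ℝ] ℝ) →L[ℝ] EuclideanSpace ℝ (Fin n) :=
  LinearMap.toContinuousLinearMap
    { toFun := fun α => chartDeriv n x y (K.sharp y (α ∘L chartDeriv n x y))
      map_add' := fun α β => by rw [ContinuousLinearMap.add_comp, map_add, map_add]
      map_smul' := fun c α => by
        rw [ContinuousLinearMap.smul_comp, map_smul, map_smul, RingHom.id_apply] }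

lemma SymTensor.inChart_apply (K : SymTensor n Q) (x y : Q)
    (α : EuclideanSpace ℝ (Fin n) →L[ℝ] ℝ) :
    K.inChart x y α = chartDeriv n x y (K.sharp y (α ∘L chartDeriv n x y)) := rfl

/-- The components of an endomorphism of the tangent space in the preferred chart at `x`. -/
def endoInChart (x y : Q) (A : TangentSpace (𝓡 n) y →ₗ[ℝ] TangentSpace (𝓡 n) y) :
    EuclideanSpace ℝ (Fin n) →L[ℝ] EuclideanSpace ℝ (Fin n) :=
  LinearMap.toContinuousLinearMap
    ((chartDeriv n x y : TangentSpace (𝓡 n) y →ₗ[ℝ] EuclideanSpace ℝ (Fin n)) ∘ₗ A ∘ₗ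
      ((chartDeriv n x y).inverse : EuclideanSpace ℝ (Fin n) →ₗ[ℝ] TangentSpace (𝓡 n) y))

lemma endoInChart_apply (x y : Q) (A : TangentSpace (𝓡 n) y →ₗ[ℝ] TangentSpace (𝓡 n) y)
    (v : EuclideanSpace ℝ (Fin n)) :
    endoInChart x y A v = chartDeriv n x y (A ((chartDeriv n x y).inverse v)) := rfl

lemma SymTensor.inChart_symm (K : SymTensor n Q) (x y : Q)
    (α β : EuclideanSpace ℝ (Fin n) →L[ℝ] ℝ) :
    α (K.inChart x y β) = β (K.inChart x y α) :=
  K.symm y (α ∘L chartDeriv n x y) (β ∘L chartDeriv n x y)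

lemma eventually_mem_source (x : Q) :
    ∀ᶠ z in 𝓝 (extChartAt (𝓡 n) x x),
      (extChartAt (𝓡 n) x).symm z ∈ (extChartAt (𝓡 n) x).source := by
  filter_upwards [extChartAt_target_mem_nhds (I := 𝓡 n) x] with z hz
  exact (extChartAt (𝓡 n) x).map_target hz

lemma extChartAt_symm_self (x : Q) :
    (extChartAt (𝓡 n) x).symm (extChartAt (𝓡 n) x x) = x := extChartAt_to_inv x

lemma diff_congr {f h : Q → ℝ} {x : Q} (hfh : f =ᶠ[𝓝 x] h) (v : TangentSpace (𝓡 n) x) :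
    diff n f x v = diff n h x v := by
  have h1 := hfh.mfderiv_eq (I := 𝓡 n) (I' := 𝓘(ℝ, ℝ))
  exact congrArg (fun L : EuclideanSpace ℝ (Fin n) →L[ℝ] ℝ => L v) h1

lemma FunSmoothAt.differentiableAt {f : Q → ℝ} {x : Q} (hf : FunSmoothAt n f x) :
    DifferentiableAt ℝ (fun z => f ((extChartAt (𝓡 n) x).symm z)) (extChartAt (𝓡 n) x x) := by
  have h := (contMDiffAt_iff.1 hf).2
  rw [ModelWithCorners.range_eq_univ, contDiffWithinAt_univ] at h
  exact h.differentiableAt (by simp)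

lemma funSmoothAt_clm_comp_extChartAt (x : Q) (α : EuclideanSpace ℝ (Fin n) →L[ℝ] ℝ) :
    FunSmoothAt n (α ∘ extChartAt (𝓡 n) x) x :=
  α.contMDiff.contMDiffAt.comp x contMDiffAt_extChartAt

variable [IsManifold (𝓡 n) ∞ Q]

lemma chartDeriv_isInvertible {x y : Q} (hy : y ∈ (extChartAt (𝓡 n) x).source) :
    (chartDeriv n x y).IsInvertible :=
  isInvertible_mfderiv_extChartAt hy

lemma endoInChart_chartDeriv {x y : Q} (hy : y ∈ (extChartAt (𝓡 n) x).source)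
    (A : TangentSpace (𝓡 n) y →ₗ[ℝ] TangentSpace (𝓡 n) y) (v : TangentSpace (𝓡 n) y) :
    endoInChart x y A (chartDeriv n x y v) = chartDeriv n x y (A v) := by
  rw [endoInChart_apply, (chartDeriv_isInvertible hy).inverse_apply_self]

lemma diff_comp_extChartAt {x y : Q} (hy : y ∈ (extChartAt (𝓡 n) x).source)
    {g : EuclideanSpace ℝ (Fin n) → ℝ} (hg : DifferentiableAt ℝ g (extChartAt (𝓡 n) x y))
    (v : TangentSpace (𝓡 n) y) :
    diff n (g ∘ extChartAt (𝓡 n) x) y v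
      = fderiv ℝ g (extChartAt (𝓡 n) x y) (chartDeriv n x y v) := by
  have hy' : y ∈ (chartAt (EuclideanSpace ℝ (Fin n)) x).source := by
    rwa [← extChartAt_source (I := 𝓡 n)]
  have h := mfderiv_comp_apply y hg.mdifferentiableAt
    (mdifferentiableAt_extChartAt (I := 𝓡 n) hy') v
  rw [mfderiv_eq_fderiv] at h
  exact h

lemma diff_clm_comp_extChartAt {x y : Q} (hy : y ∈ (extChartAt (𝓡 n) x).source)
    (α : EuclideanSpace ℝ (Fin n) →L[ℝ] ℝ) :
    diff n (α ∘ extChartAt (𝓡 n) x) y = α ∘L chartDeriv n x y := by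
  ext v
  rw [diff_comp_extChartAt hy α.differentiableAt, ContinuousLinearMap.fderiv]
  rfl

lemma diff_eq_fderiv {f : Q → ℝ} {x : Q} {g : EuclideanSpace ℝ (Fin n) → ℝ}
    (hg : DifferentiableAt ℝ g (extChartAt (𝓡 n) x x))
    (hfg : ∀ᶠ z in 𝓝 (extChartAt (𝓡 n) x x), f ((extChartAt (𝓡 n) x).symm z) = g z)
    (v : TangentSpace (𝓡 n) x) :
    diff n f x v = fderiv ℝ g (extChartAt (𝓡 n) x x) (chartDeriv n x x v) := by
  rw [← diff_comp_extChartAt (mem_extChartAt_source x) hg]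
  refine diff_congr ?_ v
  filter_upwards [(continuousAt_extChartAt (I := 𝓡 n) x).eventually hfg,
    extChartAt_source_mem_nhds (I := 𝓡 n) x] with y hy hys
  rw [(extChartAt (𝓡 n) x).left_inv hys] at hy
  exact hy

lemma SymTensor.onDiff_clm (K : SymTensor n Q) {x y : Q} (hy : y ∈ (extChartAt (𝓡 n) x).source)
    (α β : EuclideanSpace ℝ (Fin n) →L[ℝ] ℝ) :
    K.onDiff (α ∘ extChartAt (𝓡 n) x) (β ∘ extChartAt (𝓡 n) x) y = α (K.inChart x y β) := by
  rw [SymTensor.onDiff, diff_clm_comp_extChartAt hy, diff_clm_comp_extChartAt hy]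
  rfl

/-- Each component is `K(df, dh)` with `f`, `h` linear in the chart coordinates, so the smoothness
field of `SymTensor` applies. -/
lemma SymTensor.differentiableAt_inChart (K : SymTensor n Q) (x : Q) :
    DifferentiableAt ℝ (fun z => K.inChart x ((extChartAt (𝓡 n) x).symm z))
      (extChartAt (𝓡 n) x x) := by
  refine differentiableAt_clm_of_apply fun β => differentiableAt_euclidean.2 fun i => ?_
  let α : EuclideanSpace ℝ (Fin n) →L[ℝ] ℝ := EuclideanSpace.proj i
  have h : FunSmoothAt n (K.onDiff (α ∘ extChartAt (𝓡 n) x) (β ∘ extChartAt (𝓡 n) x)) x :=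
    K.smooth _ _ x (funSmoothAt_clm_comp_extChartAt x α) (funSmoothAt_clm_comp_extChartAt x β)
  refine h.differentiableAt.congr_of_eventuallyEq ?_
  filter_upwards [eventually_mem_source x] with z hz
  exact (K.onDiff_clm hz α β).symm

/-- The pullback of a vector field to the model space under the inverse of the preferred chart at
`x`. -/
def VField.pullbackChart (X : VField n Q) (x : Q) :
    EuclideanSpace ℝ (Fin n) → EuclideanSpace ℝ (Fin n) :=
  VectorField.mpullbackWithin 𝓘(ℝ, EuclideanSpace ℝ (Fin n)) (𝓡 n) (extChartAt (𝓡 n) x).symm X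
    (Set.range (𝓡 n))

/-- Links the pullback defining `mlieBracket` to components: the derivatives of the chart and of its
inverse are mutually inverse. -/
lemma VField.pullbackChart_eventuallyEq (X : VField n Q) (x : Q) :
    X.pullbackChart x =ᶠ[𝓝 (extChartAt (𝓡 n) x x)]
      fun z => X.inChart x ((extChartAt (𝓡 n) x).symm z) := by
  filter_upwards [extChartAt_target_mem_nhds (I := 𝓡 n) x] with z hz
  have h1 := isInvertible_mfderivWithin_extChartAt_symm (I := 𝓡 n) hz
  have h2 := mfderivWithin_extChartAt_symm_comp_mfderiv_extChartAt (I := 𝓡 n) hz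
  refine (h1.inverse_apply_eq).2 ?_
  exact (congrArg (fun L => L (X ((extChartAt (𝓡 n) x).symm z))) h2).symm

lemma VField.SmoothAt.differentiableAt_inChart {X : VField n Q} {x : Q} (hX : X.SmoothAt x) :
    DifferentiableAt ℝ (fun z => X.inChart x ((extChartAt (𝓡 n) x).symm z))
      (extChartAt (𝓡 n) x x) := by
  have h1 := (ContMDiffAt.mdifferentiableAt hX (by simp)).mdifferentiableWithinAt (s := Set.univ)
  have h2 : DifferentiableWithinAt ℝ (X.pullbackChart x)
      ((extChartAt (𝓡 n) x).symm ⁻¹' Set.univ ∩ Set.range (𝓡 n)) (extChartAt (𝓡 n) x x) :=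
    h1.differentiableWithinAt_mpullbackWithin_vectorField
  rw [ModelWithCorners.range_eq_univ, Set.preimage_univ, Set.inter_univ,
    differentiableWithinAt_univ] at h2
  exact h2.congr_of_eventuallyEq (X.pullbackChart_eventuallyEq x).symm

lemma chartDeriv_mlieBracket (Y Z : VField n Q) (x : Q) :
    chartDeriv n x x (VectorField.mlieBracket (𝓡 n) Y Z x)
      = VectorField.lieBracket ℝ (fun z => Y.inChart x ((extChartAt (𝓡 n) x).symm z))
          (fun z => Z.inChart x ((extChartAt (𝓡 n) x).symm z)) (extChartAt (𝓡 n) x x) := by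
  have h : VectorField.mlieBracket (𝓡 n) Y Z x = (chartDeriv n x x).inverse
    (VectorField.lieBracketWithin ℝ (Y.pullbackChart x) (Z.pullbackChart x)
      ((extChartAt (𝓡 n) x).symm ⁻¹' Set.univ ∩ Set.range (𝓡 n)) (extChartAt (𝓡 n) x x)) := rfl
  rw [h, (chartDeriv_isInvertible (mem_extChartAt_source x)).self_apply_inverse,
    ModelWithCorners.range_eq_univ, Set.preimage_univ, Set.inter_univ,
    VectorField.lieBracketWithin_univ]
  exact (Y.pullbackChart_eventuallyEq x).lieBracket_vectorField_eq
    (Z.pullbackChart_eventuallyEq x)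

/-- The vector field with constant components in the preferred chart at `x`. -/
def constInChart (x : Q) (a : EuclideanSpace ℝ (Fin n)) : VField n Q :=
  fun y => (chartDeriv n x y).inverse a

lemma constInChart_smoothAt (x : Q) (a : EuclideanSpace ℝ (Fin n)) :
    (constInChart x a).SmoothAt x := by
  refine ContMDiffAt.mpullback_vectorField_preimage (n := ∞)
    (V := fun _ : EuclideanSpace ℝ (Fin n) => a) ?_
    contMDiffAt_extChartAt (isInvertible_mfderiv_extChartAt (mem_extChartAt_source x)) (by simp)
  exact contMDiffAt_vectorSpace_iff_contDiffAt.2 contDiffAt_const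

lemma constInChart_inChart {x y : Q} (hy : y ∈ (extChartAt (𝓡 n) x).source)
    (a : EuclideanSpace ℝ (Fin n)) : (constInChart x a).inChart x y = a :=
  (chartDeriv_isInvertible hy).self_apply_inverse a

end Chart

/-! ### The mixed tensor and the tensor equations in a chart. -/

section Chart

variable {n : ℕ} {Q : Type*} [TopologicalSpace Q] [ChartedSpace (EuclideanSpace ℝ (Fin n)) Q]

lemma Metric.mixed_sharp (G : Metric n Q) (L : SymTensor n Q) (x : Q)
    (α : TangentSpace (𝓡 n) x →L[ℝ] ℝ) : G.mixed L x (G.sharp x α) = L.sharp x α :=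
  congrArg (L.sharp x)
    ((LinearEquiv.ofBijective (G.sharp x) (G.nondegenerate x)).symm_apply_apply α)

/-- The components of the mixed tensor in the preferred chart at `x`. -/
def Metric.mixedInChart (G : Metric n Q) (L : SymTensor n Q) (x y : Q) :
    EuclideanSpace ℝ (Fin n) →L[ℝ] EuclideanSpace ℝ (Fin n) :=
  endoInChart x y (G.mixed L y)

variable [IsManifold (𝓡 n) ∞ Q]

lemma Metric.inChart_bijective (G : Metric n Q) {x y : Q}
    (hy : y ∈ (extChartAt (𝓡 n) x).source) : Function.Bijective (G.toSymTensor.inChart x y) := by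
  have hΦ := chartDeriv_isInvertible hy
  constructor
  · intro α β h
    have h1 := (G.nondegenerate y).1 (hΦ.injective h)
    ext v
    obtain ⟨w, rfl⟩ := hΦ.surjective v
    exact congrArg (fun L => L w) h1
  · intro v
    obtain ⟨w, rfl⟩ := hΦ.surjective v
    obtain ⟨γ, rfl⟩ := (G.nondegenerate y).2 w
    refine ⟨γ ∘L (chartDeriv n x y).inverse, ?_⟩
    rw [SymTensor.inChart_apply, ContinuousLinearMap.comp_assoc, hΦ.inverse_comp_self,
      ContinuousLinearMap.comp_id]

lemma Metric.mixedInChart_comp_inChart (G : Metric n Q) (L : SymTensor n Q) {x y : Q}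
    (hy : y ∈ (extChartAt (𝓡 n) x).source) :
    G.mixedInChart L x y ∘L G.toSymTensor.inChart x y = L.inChart x y := by
  ext1 α
  rw [ContinuousLinearMap.comp_apply, Metric.mixedInChart, SymTensor.inChart_apply,
    endoInChart_chartDeriv hy, G.mixed_sharp]
  rfl

lemma Metric.inChart_isInvertible (G : Metric n Q) {x y : Q}
    (hy : y ∈ (extChartAt (𝓡 n) x).source) : (G.toSymTensor.inChart x y).IsInvertible :=
  ⟨(LinearEquiv.ofBijective (G.toSymTensor.inChart x y : (EuclideanSpace ℝ (Fin n) →L[ℝ] ℝ) →ₗ[ℝ]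
    EuclideanSpace ℝ (Fin n)) (G.inChart_bijective hy)).toContinuousLinearEquiv, rfl⟩

lemma Metric.differentiableAt_mixedInChart (G : Metric n Q) (L : SymTensor n Q) (x : Q) :
    DifferentiableAt ℝ (fun z => G.mixedInChart L x ((extChartAt (𝓡 n) x).symm z))
      (extChartAt (𝓡 n) x x) := by
  have hinv := differentiableAt_clm_inverse (G.toSymTensor.differentiableAt_inChart x)
    (G.inChart_isInvertible (eventually_mem_source x).self_of_nhds)
  refine ((L.differentiableAt_inChart x).clm_comp hinv).congr_of_eventuallyEq ?_
  filter_upwards [eventually_mem_source x] with z hz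
  rw [← G.mixedInChart_comp_inChart L hz, ContinuousLinearMap.comp_assoc,
    (G.inChart_isInvertible hz).self_comp_inverse, ContinuousLinearMap.comp_id]

lemma Metric.mixedInChart_charpoly_separable (G : Metric n Q) (L : SymTensor n Q) {x y : Q}
    (hy : y ∈ (extChartAt (𝓡 n) x).source) (h : SimpleEigenvalues (G.mixed L y)) :
    (G.mixedInChart L x y : EuclideanSpace ℝ (Fin n) →ₗ[ℝ]
      EuclideanSpace ℝ (Fin n)).charpoly.Separable := by
  have : Module.Finite ℝ (TangentSpace (𝓡 n) y) :=
    inferInstanceAs (Module.Finite ℝ (EuclideanSpace ℝ (Fin n)))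
  obtain ⟨e, he⟩ := chartDeriv_isInvertible hy
  have h1 : (G.mixedInChart L x y : EuclideanSpace ℝ (Fin n) →ₗ[ℝ] EuclideanSpace ℝ (Fin n))
      = e.toLinearEquiv.conj (G.mixed L y) := by
    ext1 v
    have h2 : G.mixedInChart L x y v
      = chartDeriv n x y (G.mixed L y ((chartDeriv n x y).inverse v)) := rfl
    rw [← he, ContinuousLinearMap.inverse_equiv] at h2
    exact h2
  rw [h1, LinearEquiv.charpoly_conj]
  exact h

/-- On fields with constant components the brackets involve only derivatives of `A`, which leaves
the coordinate formula of the torsion. -/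
lemma mixedInChart_torsion {G : Metric n Q} {L : SymTensor n Q} {x : Q}
    (hT : ∀ Y Z : VField n Q, Y.SmoothAt x → Z.SmoothAt x → nijenhuis (G.mixed L) Y Z x = 0)
    (a b : EuclideanSpace ℝ (Fin n)) :
    let A := fun z => G.mixedInChart L x ((extChartAt (𝓡 n) x).symm z)
    let z := extChartAt (𝓡 n) x x
    fderiv ℝ A z (A z a) b - fderiv ℝ A z (A z b) a + A z (fderiv ℝ A z b a)
      - A z (fderiv ℝ A z a b) = 0 := by
  intro A z
  have hA : DifferentiableAt ℝ A z := G.differentiableAt_mixedInChart L x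
  have hAz : A z = endoInChart x x (G.mixed L x) := by
    simp only [A, z, extChartAt_symm_self]
    rfl
  have hconst (c : EuclideanSpace ℝ (Fin n)) :
      (fun z => (constInChart x c).inChart x ((extChartAt (𝓡 n) x).symm z)) =ᶠ[𝓝 z]
        fun _ => c := by
    filter_upwards [eventually_mem_source x] with z hz
    exact constInChart_inChart hz c
  have hmix (c : EuclideanSpace ℝ (Fin n)) :
      (fun z => VField.inChart (fun y => G.mixed L y (constInChart x c y)) x
        ((extChartAt (𝓡 n) x).symm z)) =ᶠ[𝓝 z] fun z => A z c :=
    Eventually.of_forall fun z => rfl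
  have hder (c v : EuclideanSpace ℝ (Fin n)) : fderiv ℝ (fun z => A z c) z v = fderiv ℝ A z v c := by
    rw [fderiv_clm_apply hA (differentiableAt_const c)]
    simp
  have hmem := mem_extChartAt_source (I := 𝓡 n) x
  have h := congrArg (chartDeriv n x x) (hT _ _ (constInChart_smoothAt x a)
    (constInChart_smoothAt x b))
  rw [nijenhuis, map_add, map_sub, map_sub, map_zero, ← endoInChart_chartDeriv hmem,
    ← endoInChart_chartDeriv hmem, ← endoInChart_chartDeriv hmem, ← endoInChart_chartDeriv hmem,
    chartDeriv_mlieBracket, chartDeriv_mlieBracket, chartDeriv_mlieBracket, chartDeriv_mlieBracket,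
    (hmix a).lieBracket_vectorField_eq (hmix b), (hmix a).lieBracket_vectorField_eq (hconst b),
    (hconst a).lieBracket_vectorField_eq (hmix b),
    (hconst a).lieBracket_vectorField_eq (hconst b), ← hAz] at h
  simp only [VectorField.lieBracket, hder, fderiv_fun_const, Pi.zero_apply,
    _root_.zero_apply, sub_zero, zero_sub, map_zero, map_neg, add_zero] at h
  rw [← h]
  abel

lemma SymTensor.diff_onDiff_clm (K : SymTensor n Q) (x : Q)
    (α β : EuclideanSpace ℝ (Fin n) →L[ℝ] ℝ) (v : TangentSpace (𝓡 n) x) :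
    diff n (K.onDiff (α ∘ extChartAt (𝓡 n) x) (β ∘ extChartAt (𝓡 n) x)) x v
      = α (fderiv ℝ (fun z => K.inChart x ((extChartAt (𝓡 n) x).symm z)) (extChartAt (𝓡 n) x x)
        (chartDeriv n x x v) β) := by
  have hK := K.differentiableAt_inChart x
  rw [← fderiv_clm_apply_const hK]
  refine diff_eq_fderiv
    (α.differentiableAt.comp _ (hK.clm_apply (differentiableAt_const β))) ?_ v
  filter_upwards [eventually_mem_source x] with z hz
  exact K.onDiff_clm hz α β

lemma VField.SmoothAt.diff_deriv_clm {X : VField n Q} {x : Q} (hX : X.SmoothAt x)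
    (α : EuclideanSpace ℝ (Fin n) →L[ℝ] ℝ) (v : TangentSpace (𝓡 n) x) :
    diff n (X.deriv (α ∘ extChartAt (𝓡 n) x)) x v
      = α (fderiv ℝ (fun z => X.inChart x ((extChartAt (𝓡 n) x).symm z)) (extChartAt (𝓡 n) x x)
        (chartDeriv n x x v)) := by
  have hXd := hX.differentiableAt_inChart
  have hd := α.differentiableAt.comp _ hXd
  rw [diff_eq_fderiv hd ?_ v]
  · rw [fderiv_comp _ α.differentiableAt hXd, ContinuousLinearMap.fderiv]
    rfl
  · filter_upwards [eventually_mem_source x] with z hz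
    rw [VField.deriv, diff_clm_comp_extChartAt hz]
    rfl

lemma SymTensor.lie_clm (K : SymTensor n Q) {X : VField n Q} {x : Q} (hX : X.SmoothAt x)
    (α β : EuclideanSpace ℝ (Fin n) →L[ℝ] ℝ) :
    K.lie X (α ∘ extChartAt (𝓡 n) x) (β ∘ extChartAt (𝓡 n) x) x
      = α (fderiv ℝ (fun z => K.inChart x ((extChartAt (𝓡 n) x).symm z)) (extChartAt (𝓡 n) x x)
          (X.inChart x x) β)
        - α (fderiv ℝ (fun z => X.inChart x ((extChartAt (𝓡 n) x).symm z)) (extChartAt (𝓡 n) x x)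
          (K.inChart x x β))
        - β (fderiv ℝ (fun z => X.inChart x ((extChartAt (𝓡 n) x).symm z)) (extChartAt (𝓡 n) x x)
          (K.inChart x x α)) := by
  have hmem := mem_extChartAt_source (I := 𝓡 n) x
  have hsymm : K.onDiff (α ∘ extChartAt (𝓡 n) x) (X.deriv (β ∘ extChartAt (𝓡 n) x)) x
      = K.onDiff (X.deriv (β ∘ extChartAt (𝓡 n) x)) (α ∘ extChartAt (𝓡 n) x) x := K.symm _ _ _
  rw [SymTensor.lie, hsymm, VField.deriv, K.diff_onDiff_clm]
  simp only [SymTensor.onDiff, hX.diff_deriv_clm, diff_clm_comp_extChartAt hmem]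
  rfl

/-- For `f` linear in the coordinates, `df` has constant components, so only first derivatives of
the components of `K` and `G` occur. -/
lemma SymTensor.schouten_clm (K G : SymTensor n Q) (x : Q)
    (α : EuclideanSpace ℝ (Fin n) →L[ℝ] ℝ) :
    K.schouten G (α ∘ extChartAt (𝓡 n) x) x
      = 2 * (α (fderiv ℝ (fun z => G.inChart x ((extChartAt (𝓡 n) x).symm z))
          (extChartAt (𝓡 n) x x) (K.inChart x x α) α)
        - α (fderiv ℝ (fun z => K.inChart x ((extChartAt (𝓡 n) x).symm z))
          (extChartAt (𝓡 n) x x) (G.inChart x x α) α)) := by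
  have hmem := mem_extChartAt_source (I := 𝓡 n) x
  have hsymm (K : SymTensor n Q) (f h : Q → ℝ) : K.onDiff f h x = K.onDiff h f x := K.symm _ _ _
  rw [SymTensor.schouten, hsymm K, hsymm G, SymTensor.onDiff, SymTensor.onDiff, G.diff_onDiff_clm,
    K.diff_onDiff_clm, diff_clm_comp_extChartAt hmem]
  rfl

end Chart
end PseudoRiem

end

/-! ### Reduction of the theorem to the chart at a point. -/

theorem theorem3p10 (n : ℕ) (hn : 2 < n) (Q : Type*) [TopologicalSpace Q]
    [ChartedSpace (EuclideanSpace ℝ (Fin n)) Q] [IsManifold (𝓡 n) ∞ Q]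
    (G : PseudoRiem.Metric n Q) (L : PseudoRiem.SymTensor n Q) (hL : G.IsLTensor L)
    (E : PseudoRiem.VField n Q) (hE : PseudoRiem.IsEigenvectorField (G.mixed L) E)
    (X : PseudoRiem.VField n Q) (φ : Q → ℝ) (hX : ∀ x, X x = φ x • E x) :
    ¬ G.IsProperCKV X := by
  rintro ⟨F, hF, hXs, hCKV⟩
  refine hF (funext fun x => ?_)
  obtain ⟨C, -, hC⟩ := hL.isCKT
  let e := extChartAt (𝓡 n) x
  have hself : e.symm (e x) = x := PseudoRiem.extChartAt_symm_self x
  have hmem : x ∈ e.source := mem_extChartAt_source x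
  have hAz : G.mixedInChart L x (e.symm (e x)) = G.mixedInChart L x x := by rw [hself]
  have hGz : G.toSymTensor.inChart x (e.symm (e x)) = G.toSymTensor.inChart x x := by rw [hself]
  have hXz : X.inChart x (e.symm (e x)) = X.inChart x x := by rw [hself]
  have hcomp := PseudoRiem.eventually_mem_source (n := n) x |>.mono
    fun z hz => G.mixedInChart_comp_inChart L hz
  refine PseudoRiem.conformal_factor_eq_zero_of_chart (V := EuclideanSpace ℝ (Fin n))
    (G := fun z => G.toSymTensor.inChart x (e.symm z))
    (A := fun z => G.mixedInChart L x (e.symm z)) (X := fun z => X.inChart x (e.symm z))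
    (z := e x) (C := C.inChart x x) (F := F x) (by simpa using hn)
    (G.toSymTensor.differentiableAt_inChart x) (G.differentiableAt_mixedInChart L x)
    (hXs x).differentiableAt_inChart ?_
    (fun α β => Filter.Eventually.of_forall fun z => G.toSymTensor.inChart_symm x _ α β)
    (fun α β => ?_) ?_ ?_ (PseudoRiem.mixedInChart_torsion fun Y Z => hL.torsion Y Z x)
    (fun α β => ?_) (fun α => ?_)
  · simpa only [hGz] using G.inChart_bijective hmem
  · filter_upwards [hcomp] with z hz
    rw [hz]
    exact L.inChart_symm x _ α β
  · simpa only [hAz] using G.mixedInChart_charpoly_separable L hmem (hL.simple x)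
  · filter_upwards [PseudoRiem.eventually_mem_source (n := n) x] with z hz
    obtain ⟨u, hu⟩ := hE (e.symm z)
    refine ⟨u, ?_⟩
    -- This holds at the zeros of `φ` too, and asks no smoothness of `E` or `φ`: only `X` is ever
    -- differentiated.
    have h1 : G.mixed L (e.symm z) (X (e.symm z)) = u • X (e.symm z) := by
      rw [hX, map_smul, hu.apply_eq_smul, smul_comm]
    exact (PseudoRiem.endoInChart_chartDeriv hz _ _).trans (by rw [h1, map_smul]; rfl)
  · have h := hCKV x (β ∘ e) (α ∘ e) (PseudoRiem.funSmoothAt_clm_comp_extChartAt x β)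
      (PseudoRiem.funSmoothAt_clm_comp_extChartAt x α)
    rw [PseudoRiem.SymTensor.lie_clm _ (hXs x), PseudoRiem.SymTensor.onDiff_clm _ hmem] at h
    simp only [hGz, hXz]
    linarith
  · have h := hC x (α ∘ e) (PseudoRiem.funSmoothAt_clm_comp_extChartAt x α)
    rw [PseudoRiem.SymTensor.schouten_clm, PseudoRiem.SymTensor.onDiff_clm _ hmem,
      PseudoRiem.VField.deriv, PseudoRiem.diff_clm_comp_extChartAt hmem] at h
    have hLz : G.mixedInChart L x x (G.toSymTensor.inChart x x α) = L.inChart x x α :=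
      congrArg (fun K => K α) (G.mixedInChart_comp_inChart L hmem)
    have hfd := Filter.EventuallyEq.fderiv_eq (𝕜 := ℝ) hcomp
    rw [hfd]
    simp only [hAz, hGz, hLz]
    exact mul_left_cancel₀ two_ne_zero h
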